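/- Let $J\subset\mathbb R$ be a bounded interval and let $p:J\to\mathbb R$ satisfy $1<\inf_J p\le\sup_J p<\infty$ and the local log-Hölder condition on $J$: there is $C>0$ such that $|p(x)-p(y)|\le \frac{C}{-\ln|x-y|}$ for all $x,y\in J$ with $0<|x-y|\le \frac12$. Let $0\le\alpha<1$ and let $v:J\to[0,\infty)$ be a measurable weight function. For measurable $g$ on $J$ put $$\|g\|_{L^{p(\cdot)}(J)}=\inf\Big\{\lambda>0:\ \int_J\Big(\frac{|g(x)|}{\lambda}\Big)^{p(x)}dx\le1\Big\},$$ and let $L^{p(\cdot)}(J)$ be the class of measurable $f$ on $J$ with $\int_J|f(x)|^{p(x)}dx<\infty$. For $x\in J$ let $$(M^{(J)}_\alpha f)(x)=\sup_{I\ni x,\ I\subset J}\frac1{|I|^{1-\alpha}}\int_I|f(y)|\,dy,$$ where, here and below, $I$ runs over the intervals of positive length $|I|$. Then there is a finite constant $c$ such that the trace inequality $$\|v\,M^{(J)}_\alpha f\|_{L^{p(\cdot)}(J)}\le c\,\|f\|_{L^{p(\cdot)}(J)}$$ holds for all $f\in L^{p(\cdot)}(J)$ if and only if $$\sup_{I\subset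 J}\ \frac1{|I|}\int_I v(x)^{p(x)}|I|^{\alpha p(x)}\,dx<\infty .$$ -/

import Mathlib

open MeasureTheory
open scoped ENNReal NNReal

noncomputable section

namespace VarExp

/-- `I` is a subinterval of `J` of positive length (open, closed or half-open). -/
def IsSubinterval (I J : Set ℝ) : Prop :=
  I.OrdConnected ∧ I.Nontrivial ∧ I ⊆ J

/-- `p_-(E)`, the infimum of `p` over `E`, in the extended reals. -/
def expMinus (p : ℝ → ℝ) (E : Set ℝ) : EReal := ⨅ x ∈ E, (p x : EReal)

/-- `p_+(E)`, the supremum of `p` over `E`, in the extended reals. -/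
def expPlus (p : ℝ → ℝ) (E : Set ℝ) : EReal := ⨆ x ∈ E, (p x : EReal)

/-- The local log-Hölder condition on `J`. For `x = y` both sides are `0`. -/
def LogHolderOn (p : ℝ → ℝ) (J : Set ℝ) : Prop :=
  ∃ c : ℝ, 0 < c ∧ ∀ x ∈ J, ∀ y ∈ J, |x - y| ≤ 1 / 2 →
    |p x - p y| ≤ c / (-Real.log |x - y|)

/-- The modular `S_p(g) = ∫_J g(x)^{p(x)} dx` of a function with values in `[0, ∞]`. -/
def modular (p : ℝ → ℝ) (J : Set ℝ) (g : ℝ → ℝ≥0∞) : ℝ≥0∞ :=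
  ∫⁻ x in J, g x ^ p x

/-- The Luxemburg norm `inf {l > 0 : S_p(g / l) ≤ 1}` of `L^{p(·)}(J)`, evaluated at a function
with values in `[0, ∞]`; it is `∞` if there is no such `l`. -/
def luxNorm (p : ℝ → ℝ) (J : Set ℝ) (g : ℝ → ℝ≥0∞) : ℝ≥0∞ :=
  ⨅ (l : ℝ≥0) (_ : 0 < l) (_ : modular p J (fun x => g x / (l : ℝ≥0∞)) ≤ 1), (l : ℝ≥0∞)

/-- Membership in `L^{p(·)}(J)`. -/
def MemVarLp (p : ℝ → ℝ) (J : Set ℝ) (f : ℝ → ℝ) : Prop :=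
  AEMeasurable f (volume.restrict J) ∧ modular p J (fun x => ‖f x‖ₑ) < ∞

/-- The fractional maximal function
`(M_α^{(J)} f)(x) = sup_{x ∈ I ⊆ J} |I|^{-(1-α)} ∫_I |f(y)| dy`. -/
def fracMaximal (J : Set ℝ) (α : ℝ) (f : ℝ → ℝ) (x : ℝ) : ℝ≥0∞ :=
  ⨆ (I : Set ℝ) (_ : IsSubinterval I J) (_ : x ∈ I),
    (volume I ^ (1 - α))⁻¹ * ∫⁻ y in I, ‖f y‖ₑ

end VarExp

end

/-!
**Necessity.** The maximal function of the indicator of `I` is at least `|I| ^ α` on `I`, and the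
log-Hölder condition makes the norm of that indicator comparable to `|I| ^ (1 / p x)` for each
`x ∈ I`.

**Sufficiency.** For `F` with modular at most `1`, put `h = 1 + F ^ (p / s)` with
`1 < s < inf p`; then `h ∈ L^s`, and Jensen's inequality together with the log-Hölder condition
bounds `(⨍_I F) ^ p x` by a multiple of `(⨍_I h) ^ s` for `x ∈ I`. If `2 ^ k ≤ ⨍_I h < 2 ^ (k + 1)`,
then `I` lies in one component `R` of the set `O_k` covered by the intervals on which `h` has
average at least `2 ^ k`, so that
`(v M_α F) ^ p ≤ C ∑ k, 2 ^ (k s) 1_{O_k} v ^ p |R| ^ (α p)`. Integrating over each component, the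
hypothesis on `v` leaves `∑ k, 2 ^ (k s) |O_k|`, which the `L^s` bound for the Hardy–Littlewood
maximal operator controls by `∫ h ^ s`.
-/

namespace VarExp

/-! ### Intervals -/

section Interval

variable {I J : Set ℝ}

lemma abs_sub_le_volume_real (hI : I.OrdConnected) (hfin : volume I ≠ ∞) {x y : ℝ} (hx : x ∈ I)
    (hy : y ∈ I) : |x - y| ≤ volume.real I := by
  have hle : volume (Set.uIcc y x) ≤ volume I := measure_mono (hI.uIcc_subset hy hx)
  rw [Real.volume_interval] at hle
  exact (ENNReal.ofReal_le_iff_le_toReal hfin).1 hle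

namespace IsSubinterval

lemma mono {O : Set ℝ} (h : IsSubinterval I O) (hO : O ⊆ J) : IsSubinterval I J :=
  ⟨h.1, h.2.1, h.2.2.trans hO⟩

lemma measurableSet (h : IsSubinterval I J) : MeasurableSet I :=
  h.1.measurableSet

lemma interior_nonempty (h : IsSubinterval I J) : (interior I).Nonempty :=
  h.1.convex.nontrivial_iff_nonempty_interior.1 h.2.1

lemma volume_ne_zero (h : IsSubinterval I J) : volume I ≠ 0 :=
  (Measure.measure_pos_of_nonempty_interior volume h.interior_nonempty).ne'

lemma volume_ne_top (h : IsSubinterval I J) (hJ : volume J ≠ ∞) : volume I ≠ ∞ :=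
  measure_ne_top_of_subset h.2.2 hJ

end IsSubinterval

end Interval

/-- `O` is a union of intervals of positive length; such a set need not be open. -/
def IsIntervalUnion (O : Set ℝ) : Prop :=
  ∀ x ∈ O, ∃ I, IsSubinterval I O ∧ x ∈ I

namespace IsIntervalUnion

variable {O : Set ℝ} {x y : ℝ}

lemma isSubinterval_component (hO : IsIntervalUnion O) (hx : x ∈ O) :
    IsSubinterval (O.ordConnectedComponent x) O := by
  obtain ⟨I, ⟨hI, hn, hsub⟩, hxI⟩ := hO x hx
  exact ⟨inferInstance, hn.mono (Set.subset_ordConnectedComponent hxI hsub),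
    Set.ordConnectedComponent_subset⟩

lemma pairwiseDisjoint_components : (O.ordConnectedComponent '' O).PairwiseDisjoint id := by
  rintro _ ⟨x, -, rfl⟩ _ ⟨y, -, rfl⟩ hne
  refine Set.disjoint_left.2 fun z hzx hzy => hne ?_
  exact (Set.ordConnectedComponent_eq hzx).trans (Set.ordConnectedComponent_eq hzy).symm

lemma countable_components (hO : IsIntervalUnion O) : (O.ordConnectedComponent '' O).Countable := by
  refine pairwiseDisjoint_components.countable_of_nonempty_interior ?_
  rintro _ ⟨x, hx, rfl⟩
  exact (hO.isSubinterval_component hx).interior_nonempty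

lemma measurableSet_of_mem_components {R : Set ℝ} (hR : R ∈ O.ordConnectedComponent '' O) :
    MeasurableSet R := by
  obtain ⟨x, -, rfl⟩ := hR
  exact Set.OrdConnected.measurableSet inferInstance

lemma biUnion_components : ⋃ R ∈ O.ordConnectedComponent '' O, id R = O := by
  refine Set.Subset.antisymm (Set.iUnion₂_subset ?_) fun x hx => ?_
  · rintro _ ⟨x, -, rfl⟩
    exact Set.ordConnectedComponent_subset
  · exact Set.mem_biUnion (Set.mem_image_of_mem _ hx) (Set.self_mem_ordConnectedComponent.2 hx)

lemma measurableSet (hO : IsIntervalUnion O) : MeasurableSet O := by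
  rw [← biUnion_components (O := O)]
  exact .biUnion hO.countable_components fun _ hR => measurableSet_of_mem_components hR

lemma measurable_volume_component (hO : IsIntervalUnion O) :
    Measurable fun x => volume (O.ordConnectedComponent x) := by
  refine measurable_of_Ioi fun t => IsIntervalUnion.measurableSet fun x hx => ?_
  have hxO : x ∈ O := Set.nonempty_ordConnectedComponent.1 <|
    nonempty_of_measure_ne_zero (μ := volume) (pos_of_gt hx).ne'
  obtain ⟨hR, hn, -⟩ := hO.isSubinterval_component hxO
  refine ⟨_, ⟨hR, hn, fun y hy => ?_⟩, Set.self_mem_ordConnectedComponent.2 hxO⟩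
  rwa [Set.mem_preimage, ← Set.ordConnectedComponent_eq hy]

lemma measure_le_of_components (hO : IsIntervalUnion O) {μ ν : Measure ℝ}
    (h : ∀ x ∈ O, μ (O.ordConnectedComponent x) ≤ ν (O.ordConnectedComponent x)) : μ O ≤ ν O := by
  have measure_eq_tsum (ρ : Measure ℝ) :
      ρ O = ∑' R : O.ordConnectedComponent '' O, ρ (R : Set ℝ) := by
    conv_lhs => rw [← biUnion_components (O := O)]
    exact measure_biUnion hO.countable_components pairwiseDisjoint_components
      fun _ hR => measurableSet_of_mem_components hR
  rw [measure_eq_tsum μ, measure_eq_tsum ν]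
  refine ENNReal.tsum_le_tsum ?_
  rintro ⟨_, x, hx, rfl⟩
  exact h x hx

end IsIntervalUnion

/-! ### The Hardy–Littlewood maximal operator -/

/-- The union of the subintervals of `J` on which `g` has average at least `t`. It lies between
the sets where the Hardy–Littlewood maximal function of `g` relative to `J` is `> t` and `≥ t`. -/
def superlevel (J : Set ℝ) (g : ℝ → ℝ≥0∞) (t : ℝ≥0∞) : Set ℝ :=
  ⋃₀ {I | IsSubinterval I J ∧ t ≤ ⨍⁻ y in I, g y ∂volume}

section Maximal

variable {J : Set ℝ} {g : ℝ → ℝ≥0∞} {t : ℝ≥0∞}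

lemma superlevel_subset : superlevel J g t ⊆ J :=
  Set.sUnion_subset fun _ hI => hI.1.2.2

lemma isIntervalUnion_superlevel : IsIntervalUnion (superlevel J g t) := by
  rintro x ⟨I, hI, hxI⟩
  exact ⟨I, ⟨hI.1.1, hI.1.2.1, Set.subset_sUnion_of_mem hI⟩, hxI⟩

lemma exists_disjoint_subfamily_volume_sUnion_le (hJ : volume J ≠ ∞) {S : Set (Set ℝ)}
    (hS : ∀ I ∈ S, IsSubinterval I J) :
    ∃ u ⊆ S, u.Countable ∧ u.PairwiseDisjoint id ∧
      volume (⋃₀ S) ≤ 6 * ∑' I : u, volume (I : Set ℝ) := by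
  obtain ⟨u, huS, hdisj, hcov⟩ := Vitali.exists_disjoint_subfamily_covering_enlargement
    id S volume.real 2 one_lt_two (fun _ _ => measureReal_nonneg) (volume.real J)
    (fun I hI => measureReal_mono (hS I hI).2.2 hJ) (fun I hI => (hS I hI).2.1.nonempty)
  have hcount : u.Countable := hdisj.countable_of_nonempty_interior fun I hI =>
    (hS I (huS hI)).interior_nonempty
  choose! c hc using fun I (hI : I ∈ u) => (hS I (huS hI)).2.1.nonempty
  have hsub : ⋃₀ S ⊆ ⋃ I ∈ u, Metric.closedBall (c I) (3 * volume.real I) := by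
    refine Set.sUnion_subset fun A hA y hy => ?_
    obtain ⟨I, hIu, ⟨z, hzA, hzI⟩, hAI⟩ := hcov A hA
    refine Set.mem_biUnion hIu ?_
    have hyz : |y - z| ≤ volume.real A :=
      abs_sub_le_volume_real (hS A hA).1 ((hS A hA).volume_ne_top hJ) hy hzA
    have hzc : |z - c I| ≤ volume.real I :=
      abs_sub_le_volume_real (hS I (huS hIu)).1 ((hS I (huS hIu)).volume_ne_top hJ) hzI (hc I hIu)
    rw [Metric.mem_closedBall, Real.dist_eq]
    linarith [abs_sub_le y z (c I)]
  have volume_ball (I : u) :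
      volume (Metric.closedBall (c I) (3 * volume.real (I : Set ℝ))) = 6 * volume (I : Set ℝ) := by
    rw [Real.volume_closedBall, ← mul_assoc, ENNReal.ofReal_mul (by norm_num),
      ofReal_measureReal ((hS I (huS I.2)).volume_ne_top hJ)]
    norm_num
  refine ⟨u, huS, hcount, hdisj, ?_⟩
  calc volume (⋃₀ S)
      ≤ ∑' I : u, volume (Metric.closedBall (c I) (3 * volume.real (I : Set ℝ))) :=
        (measure_mono hsub).trans (measure_biUnion_le _ hcount _)
    _ = 6 * ∑' I : u, volume (I : Set ℝ) := by simp_rw [volume_ball, ENNReal.tsum_mul_left]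

lemma mul_volume_superlevel_le (hJ : volume J ≠ ∞) :
    t * volume (superlevel J g t) ≤ 6 * ∫⁻ y in J, g y := by
  obtain ⟨u, hu, hcount, hdisj, hvol⟩ := exists_disjoint_subfamily_volume_sUnion_le hJ
    (S := {I | IsSubinterval I J ∧ t ≤ ⨍⁻ y in I, g y ∂volume}) fun _ hI => hI.1
  calc t * volume (superlevel J g t) ≤ t * (6 * ∑' I : u, volume (I : Set ℝ)) := by
        gcongr
        exact hvol
    _ = 6 * ∑' I : u, volume (I : Set ℝ) * t := by
        rw [ENNReal.tsum_mul_right]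
        ring
    _ ≤ 6 * ∑' I : u, ∫⁻ y in (I : Set ℝ), g y := by
        gcongr with I
        obtain ⟨hI, ht⟩ := hu I.2
        rw [← measure_mul_setLAverage g (hI.volume_ne_top hJ)]
        gcongr
    _ = 6 * ∫⁻ y in ⋃ I ∈ u, I, g y := by
        rw [lintegral_biUnion hcount (fun I hI => (hu hI).1.measurableSet) hdisj]
    _ ≤ 6 * ∫⁻ y in J, g y := by
        gcongr
        exact Set.iUnion₂_subset fun I hI => (hu hI).1.2.2

lemma superlevel_subset_superlevel_indicator (hJ : volume J ≠ ∞) (ht : t ≠ ∞) :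
    superlevel J g t ⊆ superlevel J ({y | t ≤ 2 * g y}.indicator g) (t / 2) := by
  refine Set.sUnion_subset fun I ⟨hI, hgt⟩ => Set.subset_sUnion_of_mem ⟨hI, ?_⟩
  have hg (y : ℝ) : g y ≤ {y | t ≤ 2 * g y}.indicator g y + t / 2 := by
    by_cases hy : t ≤ 2 * g y
    · rw [Set.indicator_of_mem (s := {y | t ≤ 2 * g y}) hy]
      exact le_self_add
    · refine le_add_left ?_
      rw [ENNReal.le_div_iff_mul_le (by simp) (by simp), mul_comm]
      exact (not_le.1 hy).le
  refine (ENNReal.add_le_add_iff_right (ENNReal.div_ne_top ht two_ne_zero)).1 ?_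
  calc t / 2 + t / 2 = t := ENNReal.add_halves t
    _ ≤ ⨍⁻ y in I, ({y | t ≤ 2 * g y}.indicator g y + t / 2) ∂volume :=
        hgt.trans (lintegral_mono hg)
    _ = (⨍⁻ y in I, {y | t ≤ 2 * g y}.indicator g y ∂volume) + ⨍⁻ _ in I, t / 2 ∂volume :=
        lintegral_add_right _ measurable_const
    _ = (⨍⁻ y in I, {y | t ≤ 2 * g y}.indicator g y ∂volume) + t / 2 := by
        rw [setLAverage_const hI.volume_ne_zero (hI.volume_ne_top hJ)]

lemma mul_volume_superlevel_le_lintegral_indicator (hJ : volume J ≠ ∞) (ht : t ≠ ∞) :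
    t * volume (superlevel J g t) ≤ 12 * ∫⁻ y in J, {y | t ≤ 2 * g y}.indicator g y := by
  calc t * volume (superlevel J g t)
      = 2 * (t / 2 * volume (superlevel J g t)) := by
        rw [← mul_assoc, ENNReal.mul_div_cancel two_ne_zero ENNReal.ofNat_ne_top]
    _ ≤ 2 * (t / 2 * volume (superlevel J ({y | t ≤ 2 * g y}.indicator g) (t / 2))) := by
        gcongr
        exact superlevel_subset_superlevel_indicator hJ ht
    _ ≤ 2 * (6 * ∫⁻ y in J, {y | t ≤ 2 * g y}.indicator g y) :=
        mul_le_mul_right (mul_volume_superlevel_le hJ) 2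
    _ = 12 * ∫⁻ y in J, {y | t ≤ 2 * g y}.indicator g y := by
        rw [← mul_assoc]
        norm_num

lemma sum_range_succ_pow_le {r : ℝ≥0∞} (h0 : r ≠ 0) (ht : r ≠ ∞) (n : ℕ) :
    ∑ k ∈ Finset.range (n + 1), r ^ k ≤ (1 - r⁻¹)⁻¹ * r ^ n := by
  calc ∑ k ∈ Finset.range (n + 1), r ^ k = ∑ k ∈ Finset.range (n + 1), r⁻¹ ^ k * r ^ n := by
        rw [← Finset.sum_range_reflect]
        refine Finset.sum_congr rfl fun k hk => ?_
        have hkn : k ≤ n := Nat.lt_succ_iff.1 (Finset.mem_range.1 hk)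
        rw [Nat.add_sub_cancel, ← Nat.sub_add_cancel hkn, pow_add r, Nat.add_sub_cancel,
          mul_left_comm, ← mul_pow, ENNReal.inv_mul_cancel h0 ht, one_pow, mul_one]
    _ ≤ (∑' k : ℕ, r⁻¹ ^ k) * r ^ n := by
        rw [← Finset.sum_mul]
        gcongr
        exact ENNReal.sum_le_tsum _
    _ = (1 - r⁻¹)⁻¹ * r ^ n := by rw [ENNReal.tsum_geometric]

lemma rpow_pow_comm (z : ℝ≥0∞) (a : ℝ) (k : ℕ) : (z ^ a) ^ k = (z ^ k) ^ a := by
  simp_rw [← ENNReal.rpow_natCast, ← ENNReal.rpow_mul, mul_comm]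

lemma tsum_rpow_of_two_pow_le (z : ℝ≥0∞) {a : ℝ} (ha : 0 ≤ a) :
    ∑' k : ℕ, (if (2 : ℝ≥0∞) ^ k ≤ z then ((2 : ℝ≥0∞) ^ a) ^ k else 0) ≤
      (1 - ((2 : ℝ≥0∞) ^ a)⁻¹)⁻¹ * z ^ a := by
  have h0 : (2 : ℝ≥0∞) ^ a ≠ 0 := by simp
  have ht : (2 : ℝ≥0∞) ^ a ≠ ∞ := ENNReal.rpow_ne_top_of_nonneg ha ENNReal.ofNat_ne_top
  refine ENNReal.tsum_le_of_sum_range_le fun n => ?_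
  induction n with
  | zero => simp
  | succ n ih =>
    by_cases hn : (2 : ℝ≥0∞) ^ n ≤ z
    · calc ∑ k ∈ Finset.range (n + 1), (if (2 : ℝ≥0∞) ^ k ≤ z then ((2 : ℝ≥0∞) ^ a) ^ k else 0)
          ≤ ∑ k ∈ Finset.range (n + 1), ((2 : ℝ≥0∞) ^ a) ^ k :=
            Finset.sum_le_sum fun k _ => by split_ifs <;> simp
        _ ≤ (1 - ((2 : ℝ≥0∞) ^ a)⁻¹)⁻¹ * ((2 : ℝ≥0∞) ^ a) ^ n := sum_range_succ_pow_le h0 ht n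
        _ = (1 - ((2 : ℝ≥0∞) ^ a)⁻¹)⁻¹ * ((2 : ℝ≥0∞) ^ n) ^ a := by
            rw [rpow_pow_comm]
        _ ≤ (1 - ((2 : ℝ≥0∞) ^ a)⁻¹)⁻¹ * z ^ a := by gcongr
    · rwa [Finset.sum_range_succ, if_neg hn, add_zero]

/-- The constant in the dyadic form of the strong type `(s, s)` inequality for the maximal
operator. -/
noncomputable def strongTypeConst (s : ℝ) : ℝ≥0∞ :=
  12 * ((1 - ((2 : ℝ≥0∞) ^ (s - 1))⁻¹)⁻¹ * 2 ^ (s - 1))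

lemma strongTypeConst_ne_top {s : ℝ} (hs : 1 < s) : strongTypeConst s ≠ ∞ := by
  have hr : 1 < (2 : ℝ≥0∞) ^ (s - 1) := ENNReal.one_lt_rpow (by norm_num) (sub_pos.2 hs)
  refine ENNReal.mul_ne_top ENNReal.ofNat_ne_top (ENNReal.mul_ne_top ?_
    (ENNReal.rpow_ne_top_of_nonneg (sub_pos.2 hs).le ENNReal.ofNat_ne_top))
  rw [ENNReal.inv_ne_top]
  exact (tsub_pos_iff_lt.2 (ENNReal.inv_lt_one.2 hr)).ne'

lemma rpow_eq_rpow_sub_one_mul (z : ℝ≥0∞) {s : ℝ} (hs : 1 ≤ s) : z ^ s = z ^ (s - 1) * z := by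
  conv_lhs => rw [← sub_add_cancel s 1]
  rw [ENNReal.rpow_add_of_nonneg _ _ (sub_nonneg.2 hs) zero_le_one, ENNReal.rpow_one]

lemma tsum_rpow_mul_indicator_le {s : ℝ} (hs : 1 ≤ s) (y : ℝ) :
    ∑' k : ℕ, ((2 : ℝ≥0∞) ^ (s - 1)) ^ k * {y | (2 : ℝ≥0∞) ^ k ≤ 2 * g y}.indicator g y ≤
      (1 - ((2 : ℝ≥0∞) ^ (s - 1))⁻¹)⁻¹ * 2 ^ (s - 1) * g y ^ s := by
  have hs0 : 0 ≤ s - 1 := sub_nonneg.2 hs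
  calc ∑' k : ℕ, ((2 : ℝ≥0∞) ^ (s - 1)) ^ k * {y | (2 : ℝ≥0∞) ^ k ≤ 2 * g y}.indicator g y
      = (∑' k : ℕ, (if (2 : ℝ≥0∞) ^ k ≤ 2 * g y then ((2 : ℝ≥0∞) ^ (s - 1)) ^ k else 0)) *
          g y := by
        simp_rw [← ENNReal.tsum_mul_right, Set.indicator_apply, Set.mem_ofPred_eq, mul_ite, ite_mul,
          mul_zero, zero_mul]
    _ ≤ (1 - ((2 : ℝ≥0∞) ^ (s - 1))⁻¹)⁻¹ * (2 * g y) ^ (s - 1) * g y := by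
        gcongr
        exact tsum_rpow_of_two_pow_le _ hs0
    _ = (1 - ((2 : ℝ≥0∞) ^ (s - 1))⁻¹)⁻¹ * 2 ^ (s - 1) * g y ^ s := by
        rw [ENNReal.mul_rpow_of_nonneg _ _ hs0, rpow_eq_rpow_sub_one_mul (g y) hs]
        ring

lemma tsum_rpow_mul_volume_superlevel_le {s : ℝ} (hs : 1 ≤ s) (hJ : volume J ≠ ∞)
    (hg : AEMeasurable g (volume.restrict J)) :
    ∑' k : ℕ, ((2 : ℝ≥0∞) ^ k) ^ s * volume (superlevel J g (2 ^ k)) ≤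
      strongTypeConst s * ∫⁻ y in J, g y ^ s := by
  have hmeas (k : ℕ) : AEMeasurable ({y | (2 : ℝ≥0∞) ^ k ≤ 2 * g y}.indicator g)
      (volume.restrict J) :=
    hg.indicator₀ (nullMeasurableSet_le aemeasurable_const (hg.const_mul 2))
  calc ∑' k : ℕ, ((2 : ℝ≥0∞) ^ k) ^ s * volume (superlevel J g (2 ^ k))
      = ∑' k : ℕ, ((2 : ℝ≥0∞) ^ (s - 1)) ^ k * (2 ^ k * volume (superlevel J g (2 ^ k))) := by
        refine tsum_congr fun k => ?_
        rw [rpow_eq_rpow_sub_one_mul _ hs, rpow_pow_comm, mul_assoc]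
    _ ≤ ∑' k : ℕ, ((2 : ℝ≥0∞) ^ (s - 1)) ^ k *
          (12 * ∫⁻ y in J, {y | (2 : ℝ≥0∞) ^ k ≤ 2 * g y}.indicator g y) := by
        refine ENNReal.tsum_le_tsum fun k => mul_le_mul_right ?_ _
        exact mul_volume_superlevel_le_lintegral_indicator hJ
          (ENNReal.pow_ne_top ENNReal.ofNat_ne_top)
    _ = 12 * ∫⁻ y in J, ∑' k : ℕ, ((2 : ℝ≥0∞) ^ (s - 1)) ^ k *
          {y | (2 : ℝ≥0∞) ^ k ≤ 2 * g y}.indicator g y := by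
        rw [lintegral_tsum fun k => (hmeas k).const_mul _, ← ENNReal.tsum_mul_left]
        refine tsum_congr fun k => ?_
        rw [lintegral_const_mul'' _ (hmeas k), mul_left_comm]
    _ ≤ 12 * ∫⁻ y in J, (1 - ((2 : ℝ≥0∞) ^ (s - 1))⁻¹)⁻¹ * 2 ^ (s - 1) * g y ^ s := by
        gcongr with y
        exact tsum_rpow_mul_indicator_le hs y
    _ = strongTypeConst s * ∫⁻ y in J, g y ^ s := by
        rw [lintegral_const_mul'' _ (hg.pow_const s), strongTypeConst]
        ring

end Maximal

/-! ### Variable exponents -/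

section Exponent

variable {J I : Set ℝ} {p : ℝ → ℝ}

lemma exists_mapsTo_Icc (hp1 : 1 < expMinus p J) (hp2 : expPlus p J < ⊤) :
    ∃ s P : ℝ, 1 < s ∧ s ≤ P ∧ Set.MapsTo p J (Set.Icc s P) := by
  obtain ⟨s, hs, hsp⟩ := EReal.lt_iff_exists_real_btwn.1 hp1
  obtain ⟨P, hP, -⟩ := EReal.lt_iff_exists_real_btwn.1 hp2
  refine ⟨s, max P s, by exact_mod_cast hs, le_max_right _ _, fun x hx => ⟨?_, ?_⟩⟩
  · exact_mod_cast hsp.le.trans (iInf₂_le x hx)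
  · have hxP : (p x : EReal) ≤ P :=
      (le_iSup₂ (f := fun x (_ : x ∈ J) => (p x : EReal)) x hx).trans hP.le
    exact le_max_of_le_left (EReal.coe_le_coe_iff.1 hxP)

lemma LogHolderOn.continuousOn (hp : LogHolderOn p J) : ContinuousOn p J := by
  obtain ⟨c, -, hc⟩ := hp
  intro x hx
  have hlog : ContinuousAt (fun r : ℝ => c / (-Real.log r)) 0 := by
    rw [continuousAt_iff_punctured_nhds]
    simp only [Real.log_zero, neg_zero, div_zero]
    exact (Filter.tendsto_neg_atBot_atTop.comp Real.tendsto_log_nhdsNE_zero).const_div_atTop c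
  have hdist : Filter.Tendsto (fun y : ℝ => |x - y|) (nhdsWithin x J) (nhds 0) := by
    have hcont : ContinuousAt (fun y : ℝ => |x - y|) x := by fun_prop
    simpa using hcont.tendsto.mono_left nhdsWithin_le_nhds
  have hmod : Filter.Tendsto (fun y : ℝ => c / (-Real.log |x - y|)) (nhdsWithin x J)
      (nhds 0) := by
    have h := hlog.tendsto.comp hdist
    rwa [Real.log_zero, neg_zero, div_zero] at h
  refine tendsto_iff_norm_sub_tendsto_zero.2
    (squeeze_zero' (.of_forall fun _ => norm_nonneg _) ?_ hmod)
  filter_upwards [self_mem_nhdsWithin,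
    hdist.eventually (Iic_mem_nhds (by norm_num : (0 : ℝ) < 1 / 2))] with y hy hxy
  rw [Real.norm_eq_abs, abs_sub_comm]
  exact hc x hx y hy hxy

/-- Diening's form of the log-Hölder condition: the powers of the length of a subinterval with
exponents in the range of `p` there are comparable. Passing to the closure of the range lets the
infimum of `p` occur as an exponent. -/
def HasDieningBound (p : ℝ → ℝ) (J : Set ℝ) (K : ℝ≥0) : Prop :=
  ∀ ⦃I⦄, IsSubinterval I J → ∀ a ∈ closure (p '' I), ∀ b ∈ closure (p '' I),
    volume I ^ (a - b) ≤ K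

lemma LogHolderOn.exists_abs_sub_mul_abs_log_le (hp : LogHolderOn p J) :
    ∃ c : ℝ, ∀ x ∈ J, ∀ y ∈ J, ∀ l ≤ 1 / 2, |x - y| ≤ l → |p x - p y| * |Real.log l| ≤ c := by
  obtain ⟨c, hc0, hc⟩ := hp
  refine ⟨c, fun x hx y hy l hl hxy => ?_⟩
  rcases eq_or_ne x y with rfl | hne
  · simpa using hc0.le
  have hpos : 0 < |x - y| := abs_pos.2 (sub_ne_zero.2 hne)
  have hlog : Real.log |x - y| < 0 := Real.log_neg hpos (by linarith)
  calc |p x - p y| * |Real.log l| ≤ |p x - p y| * -Real.log |x - y| := by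
        rw [abs_of_neg (Real.log_neg (hpos.trans_le hxy) (by linarith))]
        gcongr
    _ ≤ c := (le_div_iff₀ (neg_pos.2 hlog)).1 (hc x hx y hy (hxy.trans hl))

lemma abs_log_le_one_add {l : ℝ} (hl : 1 / 2 ≤ l) : |Real.log l| ≤ 1 + l := by
  have hl0 : 0 < l := by linarith
  have hinv : l⁻¹ ≤ 2 := by
    rw [inv_le_comm₀ hl0 two_pos]
    linarith
  rw [abs_le]
  constructor <;> linarith [Real.log_le_sub_one_of_pos hl0, Real.one_sub_inv_le_log_of_pos hl0]

lemma LogHolderOn.exists_abs_sub_mul_abs_log_volume_le (hp : LogHolderOn p J)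
    (hJ : volume J ≠ ∞) (hpb : Bornology.IsBounded (p '' J)) :
    ∃ D : ℝ, ∀ I, IsSubinterval I J → ∀ x ∈ I, ∀ y ∈ I,
      |p x - p y| * |Real.log (volume.real I)| ≤ D := by
  obtain ⟨c, hc⟩ := hp.exists_abs_sub_mul_abs_log_le
  refine ⟨max c (Metric.diam (p '' J) * (1 + volume.real J)), fun I hI x hx y hy => ?_⟩
  rcases le_total (volume.real I) (1 / 2) with hl | hl
  · exact le_max_of_le_left (hc x (hI.2.2 hx) y (hI.2.2 hy) _ hl
      (abs_sub_le_volume_real hI.1 (hI.volume_ne_top hJ) hx hy))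
  · refine le_max_of_le_right (mul_le_mul ?_ ?_ (abs_nonneg _) Metric.diam_nonneg)
    · exact Metric.dist_le_diam_of_mem hpb (Set.mem_image_of_mem p (hI.2.2 hx))
        (Set.mem_image_of_mem p (hI.2.2 hy))
    · linarith [abs_log_le_one_add hl, measureReal_mono (μ := volume) hI.2.2 hJ]

lemma rpow_le_ofReal_exp {V : ℝ≥0∞} (h0 : V ≠ 0) (ht : V ≠ ∞) {e D : ℝ}
    (h : |e| * |Real.log V.toReal| ≤ D) : V ^ e ≤ ENNReal.ofReal (Real.exp D) := by
  have hpos : 0 < V.toReal := ENNReal.toReal_pos h0 ht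
  rw [← ENNReal.ofReal_toReal ht, ENNReal.ofReal_rpow_of_pos hpos, Real.rpow_def_of_pos hpos]
  refine ENNReal.ofReal_le_ofReal (Real.exp_le_exp.2 (le_trans ?_ h))
  rw [← abs_mul, mul_comm]
  exact le_abs_self _

theorem LogHolderOn.exists_hasDieningBound (hp : LogHolderOn p J) (hJ : volume J ≠ ∞)
    (hpb : Bornology.IsBounded (p '' J)) : ∃ K, HasDieningBound p J K := by
  obtain ⟨D, hD⟩ := hp.exists_abs_sub_mul_abs_log_volume_le hJ hpb
  refine ⟨(Real.exp D).toNNReal, fun I hI a ha b hb => ?_⟩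
  refine rpow_le_ofReal_exp hI.volume_ne_zero (hI.volume_ne_top hJ) ?_
  have hab : (a, b) ∈ closure ((p '' I) ×ˢ (p '' I)) := closure_prod_eq.ge ⟨ha, hb⟩
  have hclosed : IsClosed {q : ℝ × ℝ | |q.1 - q.2| * |Real.log (volume.real I)| ≤ D} :=
    isClosed_le (by fun_prop) continuous_const
  refine closure_minimal ?_ hclosed hab
  rintro ⟨_, _⟩ ⟨⟨x, hx, rfl⟩, y, hy, rfl⟩
  exact hD I hI x hx y hy

namespace HasDieningBound

variable {K : ℝ≥0} {x y : ℝ}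

lemma volume_rpow_sub_le (hK : HasDieningBound p J K) (hI : IsSubinterval I J) (hx : x ∈ I)
    (hy : y ∈ I) : volume I ^ (p x - p y) ≤ K :=
  hK hI _ (subset_closure (Set.mem_image_of_mem p hx)) _
    (subset_closure (Set.mem_image_of_mem p hy))

lemma one_le (hK : HasDieningBound p J K) (hI : IsSubinterval I J) : 1 ≤ (K : ℝ≥0∞) := by
  obtain ⟨x, hx⟩ := hI.2.1.nonempty
  simpa using hK.volume_rpow_sub_le hI hx hx

end HasDieningBound

end Exponent

/-! ### Jensen's inequality with a variable exponent -/

section Jensen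

lemma laverage_rpow_le {X : Type*} [MeasurableSpace X] {μ : Measure X} [IsFiniteMeasure μ]
    [NeZero μ] {g : X → ℝ≥0∞} (hg : AEMeasurable g μ) {q : ℝ} (hq : 1 ≤ q) :
    (⨍⁻ y, g y ∂μ) ^ q ≤ ⨍⁻ y, g y ^ q ∂μ := by
  have hq0 : 0 < q := one_pos.trans_le hq
  have h := eLpNorm'_le_eLpNorm'_of_exponent_le one_pos hq ((μ Set.univ)⁻¹ • μ)
    (hg.smul_measure _).aestronglyMeasurable
  simp only [eLpNorm', enorm_eq_self, ENNReal.rpow_one, div_one, one_div] at h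
  exact (ENNReal.le_rpow_inv_iff hq0).1 h

lemma rpow_le_one_add_rpow (a : ℝ≥0∞) {e d : ℝ} (he : 0 ≤ e) (hed : e ≤ d) :
    a ^ e ≤ 1 + a ^ d := by
  rcases le_total a 1 with ha | ha
  · exact (ENNReal.rpow_le_one ha he).trans le_self_add
  · exact (ENNReal.rpow_le_rpow_of_exponent_le ha hed).trans le_add_self

/-- The function `1 + F ^ (p / s)`, which lies in `L^s` when `F` lies in `L^{p(·)}` and whose
averages dominate those of `F` in the variable exponent Jensen inequality. -/
noncomputable def jensenMajorant (p : ℝ → ℝ) (s : ℝ) (F : ℝ → ℝ≥0∞) (y : ℝ) : ℝ≥0∞ :=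
  1 + F y ^ (p y / s)

variable {J I : Set ℝ} {p : ℝ → ℝ} {s P : ℝ} {F : ℝ → ℝ≥0∞}

lemma one_le_jensenMajorant (y : ℝ) : 1 ≤ jensenMajorant p s F y :=
  le_self_add

lemma aemeasurable_jensenMajorant (hp : AEMeasurable p (volume.restrict J))
    (hF : AEMeasurable F (volume.restrict J)) :
    AEMeasurable (jensenMajorant p s F) (volume.restrict J) :=
  (hF.pow (hp.div_const s)).const_add 1

lemma lintegral_one_add_rpow :
    ∫⁻ y in J, (1 + F y ^ p y) = volume J + modular p J F := by
  rw [lintegral_add_left measurable_const, setLIntegral_one, modular]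

lemma lintegral_jensenMajorant_rpow_le (hs : 1 ≤ s) :
    ∫⁻ y in J, jensenMajorant p s F y ^ s ≤ 2 ^ (s - 1) * (volume J + modular p J F) := by
  have hs0 : s ≠ 0 := (one_pos.trans_le hs).ne'
  have h2 : (2 : ℝ≥0∞) ^ (s - 1) ≠ ∞ :=
    ENNReal.rpow_ne_top_of_nonneg (sub_nonneg.2 hs) ENNReal.ofNat_ne_top
  rw [← lintegral_one_add_rpow, ← lintegral_const_mul' _ _ h2]
  refine lintegral_mono fun y => ?_
  calc jensenMajorant p s F y ^ s ≤ 2 ^ (s - 1) * (1 ^ s + (F y ^ (p y / s)) ^ s) :=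
        ENNReal.rpow_add_le_mul_rpow_add_rpow _ _ hs
    _ = 2 ^ (s - 1) * (1 + F y ^ p y) := by
        rw [ENNReal.one_rpow, ← ENNReal.rpow_mul, div_mul_cancel₀ _ hs0]

lemma lintegral_le_volume_add_modular (hJ : MeasurableSet J) (hp : ∀ x ∈ J, 1 ≤ p x) :
    ∫⁻ y in J, F y ≤ volume J + modular p J F := by
  rw [← lintegral_one_add_rpow]
  refine setLIntegral_mono' hJ fun y hy => ?_
  simpa only [ENNReal.rpow_one] using rpow_le_one_add_rpow (F y) zero_le_one (hp y hy)

lemma setLAverage_rpow_le_setLAverage_jensenMajorant_rpow (hI : IsSubinterval I J)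
    (hJ : volume J ≠ ∞) (hF : AEMeasurable F (volume.restrict J)) {m : ℝ} (hs : 0 < s)
    (hsm : s ≤ m) (hm : ∀ y ∈ I, m ≤ p y) :
    (⨍⁻ y in I, F y ∂volume) ^ m ≤ (⨍⁻ y in I, jensenMajorant p s F y ∂volume) ^ s := by
  have : IsFiniteMeasure (volume.restrict I) := isFiniteMeasure_restrict.2 (hI.volume_ne_top hJ)
  have : NeZero (volume.restrict I) := ⟨Measure.restrict_eq_zero.not.2 hI.volume_ne_zero⟩
  calc (⨍⁻ y in I, F y ∂volume) ^ m = ((⨍⁻ y in I, F y ∂volume) ^ (m / s)) ^ s := by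
        rw [← ENNReal.rpow_mul, div_mul_cancel₀ _ hs.ne']
    _ ≤ (⨍⁻ y in I, F y ^ (m / s) ∂volume) ^ s := by
        gcongr
        exact laverage_rpow_le (hF.mono_set hI.2.2) ((one_le_div hs).2 hsm)
    _ ≤ (⨍⁻ y in I, jensenMajorant p s F y ∂volume) ^ s := by
        refine ENNReal.rpow_le_rpow (laverage_mono_ae ?_) hs.le
        refine ae_restrict_of_forall_mem hI.measurableSet fun y hy => ?_
        exact rpow_le_one_add_rpow _ (div_nonneg (hs.le.trans hsm) hs.le)
          (div_le_div_of_nonneg_right (hm y hy) hs.le)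

lemma HasDieningBound.setLAverage_rpow_sub_le {K : ℝ≥0} (hK : HasDieningBound p J K)
    (hI : IsSubinterval I J) {a b : ℝ} (ha : a ∈ closure (p '' I))
    (hb : b ∈ closure (p '' I)) (hb0 : 0 ≤ b) (hba : b ≤ a) (haP : a ≤ P) :
    (⨍⁻ y in I, F y ∂volume) ^ (a - b) ≤ K * (1 + ∫⁻ y in J, F y) ^ P := by
  have hab : 0 ≤ a - b := sub_nonneg.2 hba
  calc (⨍⁻ y in I, F y ∂volume) ^ (a - b)
      = volume I ^ (b - a) * (∫⁻ y in I, F y) ^ (a - b) := by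
        rw [setLAverage_eq, ENNReal.div_eq_inv_mul, ENNReal.mul_rpow_of_nonneg _ _ hab,
          ENNReal.inv_rpow, ← ENNReal.rpow_neg, neg_sub]
    _ ≤ K * (1 + ∫⁻ y in J, F y) ^ (a - b) := by
        gcongr
        · exact hK hI b hb a ha
        · exact (lintegral_mono_set hI.2.2).trans le_add_self
    _ ≤ K * (1 + ∫⁻ y in J, F y) ^ P := by
        gcongr
        · exact le_self_add
        · linarith

theorem HasDieningBound.setLAverage_rpow_le {K : ℝ≥0} (hK : HasDieningBound p J K)
    (hJ : volume J ≠ ∞) (hs : 0 < s) (hp : Set.MapsTo p J (Set.Icc s P))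
    (hF : AEMeasurable F (volume.restrict J)) (hI : IsSubinterval I J) {x : ℝ} (hx : x ∈ I) :
    (⨍⁻ y in I, F y ∂volume) ^ p x ≤ K * (1 + ∫⁻ y in J, F y) ^ P *
      (⨍⁻ y in I, jensenMajorant p s F y ∂volume) ^ s := by
  have hpI : p '' I ⊆ Set.Icc s P := (Set.image_mono hI.2.2).trans hp.image_subset
  have hne : (p '' I).Nonempty := ⟨_, Set.mem_image_of_mem p hx⟩
  have hbdd : BddBelow (p '' I) := bddBelow_Icc.mono hpI
  have hmle (y : ℝ) (hy : y ∈ I) : sInf (p '' I) ≤ p y := csInf_le hbdd (Set.mem_image_of_mem p hy)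
  have hsm : s ≤ sInf (p '' I) := le_csInf hne fun a ha => (hpI ha).1
  have hm0 : 0 ≤ sInf (p '' I) := hs.le.trans hsm
  calc (⨍⁻ y in I, F y ∂volume) ^ p x
      = (⨍⁻ y in I, F y ∂volume) ^ (p x - sInf (p '' I)) *
          (⨍⁻ y in I, F y ∂volume) ^ sInf (p '' I) := by
        rw [← ENNReal.rpow_add_of_nonneg _ _ (sub_nonneg.2 (hmle x hx)) hm0, sub_add_cancel]
    _ ≤ K * (1 + ∫⁻ y in J, F y) ^ P *
          (⨍⁻ y in I, jensenMajorant p s F y ∂volume) ^ s :=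
        mul_le_mul'
          (hK.setLAverage_rpow_sub_le hI (subset_closure (Set.mem_image_of_mem p hx))
            (csInf_mem_closure hne hbdd) hm0 (hmle x hx) (hp (hI.2.2 hx)).2)
          (setLAverage_rpow_le_setLAverage_jensenMajorant_rpow hI hJ hF hs hsm hmle)

end Jensen

/-! ### The weighted modular inequality -/

/-- The fractional maximal function of a function with values in `[0, ∞]`; `fracMaximal J α f` is
the case `F = ‖f ·‖ₑ`. -/
noncomputable def eFracMaximal (J : Set ℝ) (α : ℝ) (F : ℝ → ℝ≥0∞) (x : ℝ) : ℝ≥0∞ :=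
  ⨆ (I : Set ℝ) (_ : IsSubinterval I J) (_ : x ∈ I), (volume I ^ (1 - α))⁻¹ * ∫⁻ y in I, F y

/-- The supremum over the subintervals of `J` in the testing condition on the weight `v`. -/
noncomputable def testingConst (p : ℝ → ℝ) (J : Set ℝ) (α : ℝ) (v : ℝ → ℝ≥0∞) : ℝ≥0∞ :=
  ⨆ (I : Set ℝ) (_ : IsSubinterval I J),
    (volume I)⁻¹ * ∫⁻ x in I, v x ^ p x * volume I ^ (α * p x)

/-- The integrand `v ^ p |R| ^ (α p)` of the testing condition, where `R` is the component of `O`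
that contains the point; it vanishes outside `O`. -/
noncomputable def componentWeight (p : ℝ → ℝ) (α : ℝ) (v : ℝ → ℝ≥0∞) (O : Set ℝ) : ℝ → ℝ≥0∞ :=
  O.indicator fun x => v x ^ p x * volume (O.ordConnectedComponent x) ^ (α * p x)

section Modular

variable {J I O : Set ℝ} {p : ℝ → ℝ} {s P α : ℝ} {F h v : ℝ → ℝ≥0∞} {x : ℝ}

lemma IsSubinterval.inv_volume_rpow_one_sub_mul_lintegral (hI : IsSubinterval I J)
    (hJ : volume J ≠ ∞) :
    (volume I ^ (1 - α))⁻¹ * ∫⁻ y in I, F y = volume I ^ α * ⨍⁻ y in I, F y ∂volume := by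
  rw [setLAverage_eq, ENNReal.div_eq_inv_mul, ← mul_assoc, ← ENNReal.rpow_neg,
    ← ENNReal.rpow_neg_one (volume I),
    ← ENNReal.rpow_add _ _ hI.volume_ne_zero (hI.volume_ne_top hJ), neg_sub, sub_eq_add_neg]

lemma eFracMaximal_const_mul {c : ℝ≥0∞} (hc : c ≠ ∞) :
    eFracMaximal J α (fun y => c * F y) x = c * eFracMaximal J α F x := by
  simp_rw [eFracMaximal, ENNReal.mul_iSup, lintegral_const_mul' c _ hc, mul_left_comm]

lemma lintegral_le_testingConst_mul_volume (hI : IsSubinterval I J) (hJ : volume J ≠ ∞) :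
    ∫⁻ x in I, v x ^ p x * volume I ^ (α * p x) ≤ testingConst p J α v * volume I := by
  rw [mul_comm, ← ENNReal.inv_mul_le_iff hI.volume_ne_zero (hI.volume_ne_top hJ)]
  exact le_iSup₂ (f := fun (I : Set ℝ) (_ : IsSubinterval I J) =>
    (volume I)⁻¹ * ∫⁻ x in I, v x ^ p x * volume I ^ (α * p x)) I hI

lemma aemeasurable_componentWeight (hO : IsIntervalUnion O)
    (hp : AEMeasurable p (volume.restrict J)) (hv : AEMeasurable v (volume.restrict J)) :
    AEMeasurable (componentWeight p α v O) (volume.restrict J) :=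
  ((hv.pow hp).mul (hO.measurable_volume_component.aemeasurable.pow
    (hp.const_mul α))).indicator hO.measurableSet

lemma lintegral_componentWeight_le (hO : IsIntervalUnion O) (hOJ : O ⊆ J) (hJ : volume J ≠ ∞) :
    ∫⁻ x in J, componentWeight p α v O x ≤ testingConst p J α v * volume O := by
  let φ (x : ℝ) : ℝ≥0∞ := v x ^ p x * volume (O.ordConnectedComponent x) ^ (α * p x)
  calc ∫⁻ x in J, componentWeight p α v O x = volume.withDensity φ O := by
        rw [withDensity_apply _ hO.measurableSet, componentWeight,
          setLIntegral_indicator hO.measurableSet, Set.inter_eq_left.2 hOJ]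
    _ ≤ (testingConst p J α v • volume) O := by
        refine hO.measure_le_of_components fun x hx => ?_
        have hR := (hO.isSubinterval_component hx).mono hOJ
        have hφ : Set.EqOn φ (fun y => v y ^ p y * volume (O.ordConnectedComponent x) ^ (α * p y))
            (O.ordConnectedComponent x) := fun y hy => by
          simp only [φ, Set.ordConnectedComponent_eq hy]
        rw [withDensity_apply _ hR.measurableSet, setLIntegral_congr_fun hR.measurableSet hφ]
        exact lintegral_le_testingConst_mul_volume hR hJ
    _ = testingConst p J α v * volume O := rfl

lemma mul_volume_rpow_le_componentWeight (hI : I.OrdConnected) (hsub : I ⊆ O) (hx : x ∈ I)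
    (hαp : 0 ≤ α * p x) : v x ^ p x * volume I ^ (α * p x) ≤ componentWeight p α v O x := by
  rw [componentWeight, Set.indicator_of_mem (hsub hx)]
  gcongr
  exact Set.subset_ordConnectedComponent hx hsub

lemma exists_two_pow_near {a : ℝ≥0∞} (h1 : 1 ≤ a) (ht : a ≠ ∞) :
    ∃ k : ℕ, (2 : ℝ≥0∞) ^ k ≤ a ∧ a < 2 ^ (k + 1) := by
  lift a to ℝ≥0 using ht
  obtain ⟨k, hk⟩ := exists_nat_pow_near (y := (2 : ℝ≥0)) (by exact_mod_cast h1) one_lt_two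
  exact ⟨k, by exact_mod_cast hk.1, by exact_mod_cast hk.2⟩

lemma exists_subset_superlevel_two_pow (hI : IsSubinterval I J) (hJ : volume J ≠ ∞)
    (h1 : ∀ y, 1 ≤ h y) (hfin : ∫⁻ y in J, h y ≠ ∞) :
    ∃ k : ℕ, I ⊆ superlevel J h (2 ^ k) ∧ ⨍⁻ y in I, h y ∂volume ≤ 2 * 2 ^ k := by
  have hlow : 1 ≤ ⨍⁻ y in I, h y ∂volume := by
    rw [← setLAverage_one hI.volume_ne_zero (hI.volume_ne_top hJ)]
    exact laverage_mono_ae (.of_forall h1)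
  have hI_fin : ⨍⁻ y in I, h y ∂volume ≠ ∞ :=
    (setLAverage_lt_top (ne_top_of_le_ne_top hfin (lintegral_mono_set hI.2.2))).ne
  obtain ⟨k, hk, hk'⟩ := exists_two_pow_near hlow hI_fin
  exact ⟨k, Set.subset_sUnion_of_mem ⟨hI, hk⟩, hk'.le.trans_eq (pow_succ' _ _)⟩

lemma mul_eFracMaximal_rpow_le_tsum (hJ : volume J ≠ ∞) (hα : 0 ≤ α) (hs : 0 ≤ s)
    (hp0 : 0 < p x) (h1 : ∀ y, 1 ≤ h y) (hfin : ∫⁻ y in J, h y ≠ ∞) {A : ℝ≥0∞}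
    (hA : ∀ I, IsSubinterval I J → x ∈ I →
      (⨍⁻ y in I, F y ∂volume) ^ p x ≤ A * (⨍⁻ y in I, h y ∂volume) ^ s) :
    (v x * eFracMaximal J α F x) ^ p x ≤
      A * 2 ^ s * ∑' k : ℕ, ((2 : ℝ≥0∞) ^ k) ^ s *
        componentWeight p α v (superlevel J h (2 ^ k)) x := by
  rw [← ENNReal.le_rpow_inv_iff hp0]
  simp only [eFracMaximal, ENNReal.mul_iSup]
  refine iSup_le fun I => iSup₂_le fun hI hx => ?_
  rw [ENNReal.le_rpow_inv_iff hp0]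
  obtain ⟨k, hIk, hk⟩ := exists_subset_superlevel_two_pow hI hJ h1 hfin
  calc (v x * ((volume I ^ (1 - α))⁻¹ * ∫⁻ y in I, F y)) ^ p x
      = v x ^ p x * volume I ^ (α * p x) * (⨍⁻ y in I, F y ∂volume) ^ p x := by
        rw [hI.inv_volume_rpow_one_sub_mul_lintegral hJ, ENNReal.mul_rpow_of_nonneg _ _ hp0.le,
          ENNReal.mul_rpow_of_nonneg _ _ hp0.le, ENNReal.rpow_mul, mul_assoc]
    _ ≤ componentWeight p α v (superlevel J h (2 ^ k)) x * (A * (2 * 2 ^ k) ^ s) := by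
        refine mul_le_mul'
          (mul_volume_rpow_le_componentWeight hI.1 hIk hx (mul_nonneg hα hp0.le)) ?_
        refine (hA I hI hx).trans ?_
        gcongr
    _ = A * 2 ^ s * (((2 : ℝ≥0∞) ^ k) ^ s *
          componentWeight p α v (superlevel J h (2 ^ k)) x) := by
        rw [ENNReal.mul_rpow_of_nonneg _ _ hs]
        ring
    _ ≤ A * 2 ^ s * ∑' k : ℕ, ((2 : ℝ≥0∞) ^ k) ^ s *
          componentWeight p α v (superlevel J h (2 ^ k)) x :=
        mul_le_mul_right (ENNReal.le_tsum k) _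

lemma lintegral_tsum_componentWeight_le (hs : 1 ≤ s) (hJ : volume J ≠ ∞)
    (hp : AEMeasurable p (volume.restrict J)) (hv : AEMeasurable v (volume.restrict J))
    (hh : AEMeasurable h (volume.restrict J)) :
    ∫⁻ x in J, ∑' k : ℕ, ((2 : ℝ≥0∞) ^ k) ^ s *
        componentWeight p α v (superlevel J h (2 ^ k)) x ≤
      testingConst p J α v * (strongTypeConst s * ∫⁻ y in J, h y ^ s) := by
  have hmeas (k : ℕ) : AEMeasurable (componentWeight p α v (superlevel J h (2 ^ k)))
      (volume.restrict J) :=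
    aemeasurable_componentWeight isIntervalUnion_superlevel hp hv
  calc ∫⁻ x in J, ∑' k : ℕ, ((2 : ℝ≥0∞) ^ k) ^ s *
          componentWeight p α v (superlevel J h (2 ^ k)) x
      = ∑' k : ℕ, ((2 : ℝ≥0∞) ^ k) ^ s *
          ∫⁻ x in J, componentWeight p α v (superlevel J h (2 ^ k)) x := by
        rw [lintegral_tsum fun k => (hmeas k).const_mul _]
        exact tsum_congr fun k => lintegral_const_mul'' _ (hmeas k)
    _ ≤ ∑' k : ℕ, ((2 : ℝ≥0∞) ^ k) ^ s *
          (testingConst p J α v * volume (superlevel J h (2 ^ k))) := by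
        gcongr with k
        exact lintegral_componentWeight_le isIntervalUnion_superlevel superlevel_subset hJ
    _ = testingConst p J α v *
          ∑' k : ℕ, ((2 : ℝ≥0∞) ^ k) ^ s * volume (superlevel J h (2 ^ k)) := by
        rw [← ENNReal.tsum_mul_left]
        exact tsum_congr fun k => mul_left_comm _ _ _
    _ ≤ testingConst p J α v * (strongTypeConst s * ∫⁻ y in J, h y ^ s) := by
        gcongr
        exact tsum_rpow_mul_volume_superlevel_le hs hJ hh

lemma lintegral_jensenMajorant_ne_top (hs : 1 ≤ s) (hJ : volume J ≠ ∞)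
    (hF : modular p J F ≠ ∞) : ∫⁻ y in J, jensenMajorant p s F y ≠ ∞ := by
  have hrpow : ∫⁻ y in J, jensenMajorant p s F y ≤ ∫⁻ y in J, jensenMajorant p s F y ^ s :=
    lintegral_mono fun y => ENNReal.le_rpow_self_of_one_le (one_le_jensenMajorant y) hs
  refine ne_top_of_le_ne_top (ENNReal.mul_ne_top ?_ (ENNReal.add_ne_top.2 ⟨hJ, hF⟩))
    (hrpow.trans (lintegral_jensenMajorant_rpow_le hs))
  exact ENNReal.rpow_ne_top_of_nonneg (sub_nonneg.2 hs) ENNReal.ofNat_ne_top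

lemma HasDieningBound.modular_mul_eFracMaximal_le {K : ℝ≥0} (hK : HasDieningBound p J K)
    (hJm : MeasurableSet J) (hJ : volume J ≠ ∞) (hs : 1 ≤ s)
    (hp : Set.MapsTo p J (Set.Icc s P)) (hpm : AEMeasurable p (volume.restrict J)) (hα : 0 ≤ α)
    (hv : AEMeasurable v (volume.restrict J)) (hF : AEMeasurable F (volume.restrict J))
    (hFp : modular p J F ≠ ∞) :
    modular p J (fun x => v x * eFracMaximal J α F x) ≤
      K * (1 + ∫⁻ y in J, F y) ^ P * 2 ^ s * (testingConst p J α v *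
        (strongTypeConst s * ∫⁻ y in J, jensenMajorant p s F y ^ s)) := by
  have hs0 : 0 < s := one_pos.trans_le hs
  have hh := aemeasurable_jensenMajorant (s := s) hpm hF
  calc modular p J (fun x => v x * eFracMaximal J α F x)
      ≤ ∫⁻ x in J, K * (1 + ∫⁻ y in J, F y) ^ P * 2 ^ s * ∑' k : ℕ, ((2 : ℝ≥0∞) ^ k) ^ s *
          componentWeight p α v (superlevel J (jensenMajorant p s F) (2 ^ k)) x := by
        refine setLIntegral_mono' hJm fun x hx => ?_
        exact mul_eFracMaximal_rpow_le_tsum hJ hα hs0.le (hs0.trans_le (hp hx).1)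
          one_le_jensenMajorant (lintegral_jensenMajorant_ne_top hs hJ hFp)
          fun I hI hxI => hK.setLAverage_rpow_le hJ hs0 hp hF hI hxI
    _ = K * (1 + ∫⁻ y in J, F y) ^ P * 2 ^ s * ∫⁻ x in J, ∑' k : ℕ, ((2 : ℝ≥0∞) ^ k) ^ s *
          componentWeight p α v (superlevel J (jensenMajorant p s F) (2 ^ k)) x :=
        lintegral_const_mul'' _ (.tsum fun k =>
          (aemeasurable_componentWeight isIntervalUnion_superlevel hpm hv).const_mul _)
    _ ≤ K * (1 + ∫⁻ y in J, F y) ^ P * 2 ^ s * (testingConst p J α v *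
          (strongTypeConst s * ∫⁻ y in J, jensenMajorant p s F y ^ s)) := by
        gcongr
        exact lintegral_tsum_componentWeight_le hs hJ hpm hv hh

theorem HasDieningBound.exists_modular_mul_eFracMaximal_le {K : ℝ≥0} (hK : HasDieningBound p J K)
    (hJm : MeasurableSet J) (hJ : volume J ≠ ∞) (hs : 1 < s) (hsP : s ≤ P)
    (hp : Set.MapsTo p J (Set.Icc s P)) (hpm : AEMeasurable p (volume.restrict J)) (hα : 0 ≤ α)
    (hv : AEMeasurable v (volume.restrict J)) (hB : testingConst p J α v ≠ ∞) :
    ∃ A : ℝ≥0, ∀ F : ℝ → ℝ≥0∞, AEMeasurable F (volume.restrict J) → modular p J F ≤ 1 →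
      modular p J (fun x => v x * eFracMaximal J α F x) ≤ A := by
  have hs0 : 0 ≤ s := zero_le_one.trans hs.le
  have hJ1 : volume J + 1 ≠ ∞ := ENNReal.add_ne_top.2 ⟨hJ, ENNReal.one_ne_top⟩
  have hP : (1 + (volume J + 1)) ^ P ≠ ∞ := ENNReal.rpow_ne_top_of_nonneg (hs0.trans hsP)
    (ENNReal.add_ne_top.2 ⟨ENNReal.one_ne_top, hJ1⟩)
  have h2 {e : ℝ} (he : 0 ≤ e) : (2 : ℝ≥0∞) ^ e ≠ ∞ :=
    ENNReal.rpow_ne_top_of_nonneg he ENNReal.ofNat_ne_top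
  have hA : K * (1 + (volume J + 1)) ^ P * 2 ^ s * (testingConst p J α v *
      (strongTypeConst s * (2 ^ (s - 1) * (volume J + 1)))) ≠ ∞ :=
    ENNReal.mul_ne_top (ENNReal.mul_ne_top (ENNReal.mul_ne_top ENNReal.coe_ne_top hP) (h2 hs0))
      (ENNReal.mul_ne_top hB (ENNReal.mul_ne_top (strongTypeConst_ne_top hs)
        (ENNReal.mul_ne_top (h2 (sub_nonneg.2 hs.le)) hJ1)))
  refine ⟨_, fun F hF hFp => le_of_le_of_eq ?_ (ENNReal.coe_toNNReal hA).symm⟩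
  refine (hK.modular_mul_eFracMaximal_le hJm hJ hs.le hp hpm hα hv hF
    (ne_top_of_le_ne_top ENNReal.one_ne_top hFp)).trans ?_
  have hle : volume J + modular p J F ≤ volume J + 1 := by gcongr
  gcongr
  · exact hs0.trans hsP
  · exact (lintegral_le_volume_add_modular hJm fun x hx => hs.le.trans (hp hx).1).trans hle
  · exact (lintegral_jensenMajorant_rpow_le hs.le).trans (mul_le_mul_right hle _)

end Modular

/-! ### Norm inequalities -/

section Norm

variable {J I : Set ℝ} {p : ℝ → ℝ} {f g : ℝ → ℝ≥0∞}

lemma luxNorm_le {l : ℝ≥0∞} (h0 : l ≠ 0) (ht : l ≠ ∞)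
    (h : modular p J (fun x => g x / l) ≤ 1) : luxNorm p J g ≤ l := by
  lift l to ℝ≥0 using ht
  exact iInf_le_of_le l (iInf₂_le_of_le (pos_iff_ne_zero.2 (by exact_mod_cast h0)) h le_rfl)

lemma modular_div_le_one_of_luxNorm_lt (hJ : MeasurableSet J) (hp : ∀ x ∈ J, 0 ≤ p x) {L : ℝ≥0∞}
    (h : luxNorm p J g < L) : modular p J (fun x => g x / L) ≤ 1 := by
  simp only [luxNorm, iInf_lt_iff] at h
  obtain ⟨l, -, hl, hlL⟩ := h
  refine le_trans (setLIntegral_mono' hJ fun x hx => ?_) hl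
  exact ENNReal.rpow_le_rpow (ENNReal.div_le_div_left hlL.le _) (hp x hx)

lemma modular_div_le_one (hJ : MeasurableSet J) (hp : ∀ x ∈ J, 1 ≤ p x) {A : ℝ≥0∞} (hA : 1 ≤ A)
    (h : modular p J g ≤ A) : modular p J (fun x => g x / A) ≤ 1 := by
  have hA_inv : A⁻¹ ≠ ∞ := ENNReal.inv_ne_top.2 (one_pos.trans_le hA).ne'
  calc modular p J (fun x => g x / A) ≤ ∫⁻ x in J, g x ^ p x / A := by
        refine setLIntegral_mono' hJ fun x hx => ?_
        rw [ENNReal.div_rpow_of_nonneg _ _ (zero_le_one.trans (hp x hx))]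
        exact ENNReal.div_le_div_left (ENNReal.le_rpow_self_of_one_le hA (hp x hx)) _
    _ = modular p J g / A := by
        simp only [div_eq_mul_inv, lintegral_mul_const' _ _ hA_inv, modular]
    _ ≤ 1 := ENNReal.div_le_of_le_mul (by rwa [one_mul])

lemma luxNorm_le_mul_luxNorm (hJ : MeasurableSet J) (hp : ∀ x ∈ J, 1 ≤ p x) {A : ℝ≥0}
    (hA : 1 ≤ A) (h : ∀ l : ℝ≥0, 0 < l → modular p J (fun x => f x / l) ≤ 1 →
      modular p J (fun x => g x / l) ≤ A) : luxNorm p J g ≤ A * luxNorm p J f := by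
  have hA0 : (A : ℝ≥0∞) ≠ 0 := by exact_mod_cast (one_pos.trans_le hA).ne'
  rw [luxNorm.eq_def p J f]
  simp only [ENNReal.mul_iInf_of_ne hA0 ENNReal.coe_ne_top]
  refine le_iInf fun l => le_iInf₂ fun hl hf => ?_
  have hl0 : (l : ℝ≥0∞) ≠ 0 := by exact_mod_cast hl.ne'
  refine luxNorm_le (mul_ne_zero hA0 hl0) (ENNReal.mul_ne_top ENNReal.coe_ne_top
    ENNReal.coe_ne_top) ?_
  have hdiv (x : ℝ) : g x / (A * l) = g x / l / A := by
    rw [mul_comm, div_eq_mul_inv, ENNReal.mul_inv (.inl hl0) (.inl ENNReal.coe_ne_top),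
      ← mul_assoc, ← div_eq_mul_inv, ← div_eq_mul_inv]
  simp only [hdiv]
  exact modular_div_le_one hJ hp (by exact_mod_cast hA) (h l hl hf)

lemma setLIntegral_rpow_le_of_luxNorm_lt (hJ : MeasurableSet J) (hI : MeasurableSet I)
    (hIJ : I ⊆ J) (hp : ∀ x ∈ J, 0 ≤ p x) {N B : ℝ≥0∞} (hN : N ≠ ∞) (hB : B ≠ ∞)
    (hNB : ∀ x ∈ I, N ^ p x ≤ B) (h : luxNorm p J g < N) : ∫⁻ x in I, g x ^ p x ≤ B := by
  calc ∫⁻ x in I, g x ^ p x ≤ ∫⁻ x in I, B * (g x / N) ^ p x := by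
        refine setLIntegral_mono' hI fun x hx => ?_
        calc g x ^ p x = (N * (g x / N)) ^ p x := by
              rw [ENNReal.mul_div_cancel (pos_of_gt h).ne' hN]
          _ = N ^ p x * (g x / N) ^ p x := ENNReal.mul_rpow_of_nonneg _ _ (hp x (hIJ hx))
          _ ≤ B * (g x / N) ^ p x := by
              gcongr
              exact hNB x hx
    _ = B * ∫⁻ x in I, (g x / N) ^ p x := lintegral_const_mul' _ _ hB
    _ ≤ B * modular p J (fun x => g x / N) := by
        gcongr
        exact lintegral_mono_set hIJ
    _ ≤ B := mul_le_of_le_one_right' (modular_div_le_one_of_luxNorm_lt hJ hp h)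

end Norm

theorem HasDieningBound.exists_luxNorm_mul_eFracMaximal_le {J : Set ℝ} {p : ℝ → ℝ} {s P α : ℝ}
    {v : ℝ → ℝ≥0∞} {K : ℝ≥0} (hK : HasDieningBound p J K)
    (hJm : MeasurableSet J) (hJ : volume J ≠ ∞) (hs : 1 < s) (hsP : s ≤ P)
    (hp : Set.MapsTo p J (Set.Icc s P)) (hpm : AEMeasurable p (volume.restrict J)) (hα : 0 ≤ α)
    (hv : AEMeasurable v (volume.restrict J)) (hB : testingConst p J α v ≠ ∞) :
    ∃ c : ℝ≥0, ∀ F : ℝ → ℝ≥0∞, AEMeasurable F (volume.restrict J) →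
      luxNorm p J (fun x => v x * eFracMaximal J α F x) ≤ c * luxNorm p J F := by
  obtain ⟨A, hA⟩ := hK.exists_modular_mul_eFracMaximal_le hJm hJ hs hsP hp hpm hα hv hB
  refine ⟨max A 1, fun F hF => luxNorm_le_mul_luxNorm hJm (fun x hx => hs.le.trans (hp hx).1)
    (le_max_right A 1) fun l hl hFl => ?_⟩
  have hl0 : (l : ℝ≥0∞)⁻¹ ≠ ∞ := ENNReal.inv_ne_top.2 (by exact_mod_cast hl.ne')
  have hdiv (x : ℝ) : v x * eFracMaximal J α F x / l =
      v x * eFracMaximal J α (fun y => F y / l) x := by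
    simp_rw [div_eq_mul_inv, mul_comm (F _), eFracMaximal_const_mul hl0]
    ring
  simp only [hdiv]
  exact (hA _ (hF.div_const _) hFl).trans (by exact_mod_cast le_max_left A 1)

section Necessity

variable {J I : Set ℝ} {p : ℝ → ℝ} {P α : ℝ} {v : ℝ → ℝ≥0∞} {K : ℝ≥0} {x y : ℝ}

lemma enorm_indicator_one (I : Set ℝ) (x : ℝ) :
    ‖I.indicator (1 : ℝ → ℝ) x‖ₑ = I.indicator (1 : ℝ → ℝ≥0∞) x := by
  by_cases hx : x ∈ I <;> simp [hx]

lemma volume_rpow_le_eFracMaximal_indicator (hI : IsSubinterval I J) (hJ : volume J ≠ ∞)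
    (hx : x ∈ I) : volume I ^ α ≤ eFracMaximal J α (I.indicator 1) x := by
  have havg : ⨍⁻ y in I, I.indicator (1 : ℝ → ℝ≥0∞) y ∂volume = 1 := by
    rw [setLAverage_congr_fun hI.measurableSet (Set.eqOn_indicator (f := 1))]
    exact setLAverage_one hI.volume_ne_zero (hI.volume_ne_top hJ)
  refine le_iSup_of_le I (le_iSup₂_of_le hI hx ?_)
  rw [hI.inv_volume_rpow_one_sub_mul_lintegral hJ, havg, mul_one]

lemma modular_indicator_one_div (hJ : MeasurableSet J) (hp : ∀ x ∈ J, 0 < p x)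
    (hI : MeasurableSet I) (hIJ : I ⊆ J) (r : ℝ≥0∞) :
    modular p J (fun x => I.indicator 1 x / r) = ∫⁻ x in I, (r ^ p x)⁻¹ := by
  calc modular p J (fun x => I.indicator 1 x / r)
      = ∫⁻ x in J, I.indicator (fun x => (r ^ p x)⁻¹) x := by
        refine setLIntegral_congr_fun hJ fun x hx => ?_
        by_cases hxI : x ∈ I
        · simp [hxI, ENNReal.inv_rpow]
        · simp [hxI, hp x hx]
    _ = ∫⁻ x in I, (r ^ p x)⁻¹ := by
        rw [setLIntegral_indicator hI, Set.inter_eq_left.2 hIJ]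

lemma memVarLp_indicator_one (hJ : MeasurableSet J) (hp : ∀ x ∈ J, 0 < p x)
    (hI : MeasurableSet I) (hIJ : I ⊆ J) (hfin : volume I ≠ ∞) :
    MemVarLp p J (I.indicator 1) := by
  refine ⟨(measurable_one.indicator hI).aemeasurable, ?_⟩
  have hmod : modular p J (I.indicator 1) = volume I := by
    simpa using modular_indicator_one_div hJ hp hI hIJ 1
  simp only [enorm_indicator_one, hmod]
  exact hfin.lt_top

lemma rpow_div_le_of_rpow_le {V B : ℝ≥0∞} {a q : ℝ} (hB : 1 ≤ B) (hq : 1 ≤ q) (h : V ^ a ≤ B) :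
    V ^ (a / q) ≤ B := by
  have hq0 : 0 < q := one_pos.trans_le hq
  rw [div_eq_mul_inv, ENNReal.rpow_mul, ENNReal.rpow_inv_le_iff hq0]
  exact h.trans (ENNReal.le_rpow_self_of_one_le hB hq)

namespace HasDieningBound

lemma volume_rpow_div_le (hK : HasDieningBound p J K) (hI : IsSubinterval I J)
    (hJ : volume J ≠ ∞) (hx : x ∈ I) (hy : y ∈ I) (hpy : 1 ≤ p y) :
    volume I ^ (p x / p y) ≤ K * volume I := by
  have hpy0 : p y ≠ 0 := (one_pos.trans_le hpy).ne'
  calc volume I ^ (p x / p y) = volume I ^ ((p x - p y) / p y) * volume I ^ (1 : ℝ) := by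
        rw [← ENNReal.rpow_add _ _ hI.volume_ne_zero (hI.volume_ne_top hJ), sub_div,
          div_self hpy0, sub_add_cancel]
    _ ≤ K * volume I := by
        rw [ENNReal.rpow_one]
        gcongr
        exact rpow_div_le_of_rpow_le (hK.one_le hI) hpy (hK.volume_rpow_sub_le hI hx hy)

lemma volume_le_mul_volume_rpow_div (hK : HasDieningBound p J K) (hI : IsSubinterval I J)
    (hJ : volume J ≠ ∞) (hx : x ∈ I) (hy : y ∈ I) (hpy : 1 ≤ p y) :
    volume I ≤ K * volume I ^ (p x / p y) := by
  have hpy0 : p y ≠ 0 := (one_pos.trans_le hpy).ne'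
  calc volume I = volume I ^ ((p y - p x) / p y) * volume I ^ (p x / p y) := by
        rw [← ENNReal.rpow_add _ _ hI.volume_ne_zero (hI.volume_ne_top hJ), sub_div,
          div_self hpy0, sub_add_cancel, ENNReal.rpow_one]
    _ ≤ K * volume I ^ (p x / p y) := by
        gcongr
        exact rpow_div_le_of_rpow_le (hK.one_le hI) hpy (hK.volume_rpow_sub_le hI hy hx)

lemma luxNorm_indicator_one_le (hK : HasDieningBound p J K) (hI : IsSubinterval I J)
    (hJm : MeasurableSet J) (hJ : volume J ≠ ∞) (hp : ∀ x ∈ J, 1 ≤ p x) (hy : y ∈ I) :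
    luxNorm p J (I.indicator 1) ≤ K * volume I ^ (1 / p y) := by
  have hp0 (x : ℝ) (hx : x ∈ J) : 0 < p x := one_pos.trans_le (hp x hx)
  have hV0 : volume I ^ (1 / p y) ≠ 0 :=
    (ENNReal.rpow_pos (pos_iff_ne_zero.2 hI.volume_ne_zero) (hI.volume_ne_top hJ)).ne'
  have hVt : volume I ^ (1 / p y) ≠ ∞ := ENNReal.rpow_ne_top_of_nonneg
    (one_div_nonneg.2 (hp0 y (hI.2.2 hy)).le) (hI.volume_ne_top hJ)
  refine luxNorm_le (mul_ne_zero (one_pos.trans_le (hK.one_le hI)).ne' hV0)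
    (ENNReal.mul_ne_top ENNReal.coe_ne_top hVt) ?_
  rw [modular_indicator_one_div hJm hp0 hI.measurableSet hI.2.2]
  calc ∫⁻ x in I, ((K * volume I ^ (1 / p y)) ^ p x)⁻¹ ≤ ∫⁻ _ in I, (volume I)⁻¹ := by
        refine setLIntegral_mono' hI.measurableSet fun x hx => ENNReal.inv_le_inv.2 ?_
        refine (hK.volume_le_mul_volume_rpow_div hI hJ hx hy (hp y (hI.2.2 hy))).trans ?_
        rw [ENNReal.mul_rpow_of_nonneg _ _ (hp0 x (hI.2.2 hx)).le, ← ENNReal.rpow_mul,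
          one_div_mul_eq_div]
        gcongr
        exact ENNReal.le_rpow_self_of_one_le (hK.one_le hI) (hp x (hI.2.2 hx))
    _ = 1 := by
        rw [setLIntegral_const, ENNReal.inv_mul_cancel hI.volume_ne_zero (hI.volume_ne_top hJ)]

lemma lt_mul_volume_rpow_of_le_mul_luxNorm_indicator (hK : HasDieningBound p J K)
    (hI : IsSubinterval I J) (hJm : MeasurableSet J) (hJ : volume J ≠ ∞) (hp : ∀ x ∈ J, 1 ≤ p x)
    (hy : y ∈ I) {c : ℝ≥0} {N : ℝ≥0∞} (h : N ≤ c * luxNorm p J (I.indicator 1)) :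
    N < (c + 1) * K * volume I ^ (1 / p y) := by
  have hp0 : 0 ≤ p y := zero_le_one.trans (hp y (hI.2.2 hy))
  have hK0 : (K : ℝ≥0∞) ≠ 0 := (one_pos.trans_le (hK.one_le hI)).ne'
  have hV0 : volume I ^ (1 / p y) ≠ 0 :=
    (ENNReal.rpow_pos (pos_iff_ne_zero.2 hI.volume_ne_zero) (hI.volume_ne_top hJ)).ne'
  have hV : volume I ^ (1 / p y) ≠ ∞ :=
    ENNReal.rpow_ne_top_of_nonneg (one_div_nonneg.2 hp0) (hI.volume_ne_top hJ)
  calc N ≤ c * (K * volume I ^ (1 / p y)) :=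
        h.trans (mul_le_mul_right (hK.luxNorm_indicator_one_le hI hJm hJ hp hy) _)
    _ < c * (K * volume I ^ (1 / p y)) + K * volume I ^ (1 / p y) :=
        ENNReal.lt_add_right (by finiteness) (mul_ne_zero hK0 hV0)
    _ = (c + 1) * K * volume I ^ (1 / p y) := by ring

lemma mul_volume_rpow_rpow_le (hK : HasDieningBound p J K) (hI : IsSubinterval I J)
    (hJ : volume J ≠ ∞) (hp : Set.MapsTo p J (Set.Icc 1 P)) (hx : x ∈ I) (hy : y ∈ I)
    {G : ℝ≥0∞} (hG : 1 ≤ G) :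
    (G * volume I ^ (1 / p y)) ^ p x ≤ G ^ P * K * volume I := by
  obtain ⟨hpx, hpxP⟩ := hp (hI.2.2 hx)
  rw [ENNReal.mul_rpow_of_nonneg _ _ (zero_le_one.trans hpx), ← ENNReal.rpow_mul,
    one_div_mul_eq_div, mul_assoc]
  gcongr
  exact hK.volume_rpow_div_le hI hJ hx hy (hp (hI.2.2 hy)).1

theorem testingConst_le (hK : HasDieningBound p J K) (hJm : MeasurableSet J) (hJ : volume J ≠ ∞)
    (hp : Set.MapsTo p J (Set.Icc 1 P)) (hP : 0 ≤ P) {c : ℝ≥0}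
    (hc : ∀ I, IsSubinterval I J →
      luxNorm p J (fun x => v x * eFracMaximal J α (I.indicator 1) x) ≤
        c * luxNorm p J (I.indicator 1)) :
    testingConst p J α v ≤ ((c + 1) * K) ^ P * K := by
  have hp0 (x : ℝ) (hx : x ∈ J) : 0 ≤ p x := zero_le_one.trans (hp hx).1
  refine iSup₂_le fun I hI => ?_
  have hIfin := hI.volume_ne_top hJ
  obtain ⟨y, hy⟩ := hI.2.1.nonempty
  have hlt := hK.lt_mul_volume_rpow_of_le_mul_luxNorm_indicator hI hJm hJ
    (fun x hx => (hp hx).1) hy (hc I hI)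
  have hV : volume I ^ (1 / p y) ≠ ∞ :=
    ENNReal.rpow_ne_top_of_nonneg (one_div_nonneg.2 (hp0 y (hI.2.2 hy))) hIfin
  have hG : 1 ≤ (c + 1) * (K : ℝ≥0∞) := one_le_mul le_add_self (hK.one_le hI)
  have hGt : (c + 1) * (K : ℝ≥0∞) ≠ ∞ := by exact_mod_cast ENNReal.coe_ne_top (r := (c + 1) * K)
  rw [ENNReal.inv_mul_le_iff hI.volume_ne_zero hIfin, mul_comm (volume I)]
  calc ∫⁻ x in I, v x ^ p x * volume I ^ (α * p x)
      ≤ ∫⁻ x in I, (v x * eFracMaximal J α (I.indicator 1) x) ^ p x := by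
        refine setLIntegral_mono' hI.measurableSet fun x hx => ?_
        have hpx := hp0 x (hI.2.2 hx)
        rw [ENNReal.rpow_mul, ← ENNReal.mul_rpow_of_nonneg _ _ hpx]
        gcongr
        exact volume_rpow_le_eFracMaximal_indicator hI hJ hx
    _ ≤ ((c + 1) * K) ^ P * K * volume I := by
        refine setLIntegral_rpow_le_of_luxNorm_lt hJm hI.measurableSet hI.2.2 hp0
          (ENNReal.mul_ne_top hGt hV) ?_
          (fun x hx => hK.mul_volume_rpow_rpow_le hI hJ hp hx hy hG) hlt
        exact ENNReal.mul_ne_top (ENNReal.mul_ne_top (ENNReal.rpow_ne_top_of_nonneg hP hGt)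
          ENNReal.coe_ne_top) hIfin

end HasDieningBound

end Necessity

end VarExp

open VarExp in
theorem corollary1p1_general {J : Set ℝ} (hJm : MeasurableSet J) (hJ : volume J ≠ ∞)
    {p : ℝ → ℝ} (hp1 : 1 < expMinus p J) (hp2 : expPlus p J < ⊤) (hp : LogHolderOn p J)
    {α : ℝ} (hα : 0 ≤ α) {v : ℝ → ℝ≥0∞} (hv : AEMeasurable v (volume.restrict J)) :
    (∃ c : ℝ≥0, ∀ f : ℝ → ℝ, MemVarLp p J f →
      luxNorm p J (fun x => v x * fracMaximal J α f x) ≤ c * luxNorm p J (fun x => ‖f x‖ₑ)) ↔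
    testingConst p J α v < ∞ := by
  obtain ⟨s, P, hs, hsP, hpIcc⟩ := exists_mapsTo_Icc hp1 hp2
  obtain ⟨K, hK⟩ := hp.exists_hasDieningBound hJ ((Metric.isBounded_Icc s P).subset
    hpIcc.image_subset)
  constructor
  · rintro ⟨c, hc⟩
    have hP : 0 ≤ P := by linarith
    have hp1P : Set.MapsTo p J (Set.Icc 1 P) := hpIcc.mono_right (Set.Icc_subset_Icc_left hs.le)
    refine (hK.testingConst_le hJm hJ hp1P hP (c := c) fun I hI => ?_).trans_lt <|
      ENNReal.mul_lt_top (ENNReal.rpow_lt_top_of_nonneg hP ?_) ENNReal.coe_lt_top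
    · have hmem : MemVarLp p J (I.indicator 1) := memVarLp_indicator_one hJm
        (fun x hx => one_pos.trans_le (hp1P hx).1) hI.measurableSet hI.2.2 (hI.volume_ne_top hJ)
      have h := hc _ hmem
      simp only [enorm_indicator_one, fracMaximal] at h
      exact h
    · exact_mod_cast ENNReal.coe_ne_top (r := (c + 1) * K)
  · intro hB
    obtain ⟨c, hc⟩ := hK.exists_luxNorm_mul_eFracMaximal_le hJm hJ hs hsP hpIcc
      (hp.continuousOn.aemeasurable hJm) hα hv hB.ne
    exact ⟨c, fun f hf => hc _ hf.1.enorm⟩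

theorem corollary1p1 (J : Set ℝ) (hJ : J.OrdConnected) (hJb : Bornology.IsBounded J)
    (p : ℝ → ℝ) (hp1 : 1 < VarExp.expMinus p J) (hp2 : VarExp.expPlus p J < ⊤)
    (hp : VarExp.LogHolderOn p J)
    (α : ℝ) (hα0 : 0 ≤ α) (hα1 : α < 1)
    (v : ℝ → ℝ≥0) (hv : AEMeasurable v (volume.restrict J)) :
    (∃ c : ℝ≥0, ∀ f : ℝ → ℝ, VarExp.MemVarLp p J f →
      VarExp.luxNorm p J (fun x => (v x : ℝ≥0∞) * VarExp.fracMaximal J α f x) ≤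
        (c : ℝ≥0∞) * VarExp.luxNorm p J (fun x => ‖f x‖ₑ)) ↔
    (⨆ (I : Set ℝ) (_ : VarExp.IsSubinterval I J),
      (volume I)⁻¹ * ∫⁻ x in I, (v x : ℝ≥0∞) ^ p x * volume I ^ (α * p x)) < ∞ :=
  corollary1p1_general hJ.measurableSet hJb.measure_lt_top.ne hp1 hp2 hp hα0 hv.coe_nnreal_ennreal
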